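/- Let $-\infty\le a<b\le\infty$, let $V\in L^1_{\mathrm{loc}}(a,b)$ be real-valued, let $I\subseteq\mathbb Z$, and let $M=\{x_n\}_{n\in I}\subset(a,b)$ be a set of distinct points with no accumulation point in $(a,b)$. For $\Lambda=(\alpha_n)\in\mathbb R^I$, $R=(r_n)\in(0,\infty)^I$, $\Theta=(\theta_n)\in\mathbb R^I$ put $$A_{\alpha_n,r_n,\theta_n}=\begin{pmatrix}1&\alpha_n\\0&1\end{pmatrix}\begin{pmatrix}r_n&0\\0&1/r_n\end{pmatrix}\begin{pmatrix}\cos\theta_n&-\sin\theta_n\\\sin\theta_n&\cos\theta_n\end{pmatrix}.$$ Let $\tau f=-f''+Vf$. For $z\in\mathbb C$, a solution of $(\tau_{\Lambda,R,\Theta}-z)f=0$ is a function $f$ such that $f,f'$ are (locally) absolutely continuous in $(a,b)\setminus M$, $\tau f=zf$ almost everywhere, and for all $n\in I$ the one-sided limits at $x_n$ exist and satisfy $$(f(x_n+),f'(x_n+))^T=A_{\alpha_n,r_n,\theta_n}(f(x_n-),f'(x_n-))^T;\qquad(*)$$ solutions near an endpoint are defined in the same way on a subinterval adjacent to it. The expression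 $\tau_{\Lambda,R,\Theta}$ is in the limit circle case at an endpoint if for every $z\in\mathbb C$ all solutions of $(\tau_{\Lambda,R,\Theta}-z)f=0$ are square integrable near it, and in the limit point case there if for every $z\in\mathbb C$ some solution is not. It is regular at $a$ if $a$ is finite, $V\in L^1_{\mathrm{loc}}[a,b)$ and $a$ is not an accumulation point of $M$; similarly at $b$. Write $[f,g]_x=\overline{f(x+)}g'(x+)-\overline{f'(x+)}g(x+)$, and $[f,g]_a$, $[f,g]_b$ for its limits as $x\to a+$, $x\to b-$. Fix $R$ and $\Theta$. Assume that either $\tau_{\Lambda,R,\Theta}$ is regular at $a$ (a condition independent of $\Lambda$), and then fix a non-trivial real solution $v$, near $a$, of $(\tau_{\Lambda,R,\Theta}-\lambda)v=0$ for some $\lambda\in\mathbb R$ (near $a$ this equation does not depend on $\Lambda$), or $\tau_{\Lambda,R,\Theta}$ is in the limit point case at $a$ for every $\Lambda\in\mathbb R^I$; assume the same at $b$, with a solution $w$ near $b$ in the regular case. Let $H_\Lambda$ be the operator in $L^2(a,b)$ given by $H_\Lambda f=\tau f$ on the set of all $f\in L^2(a,b)$ such that $f,f'$ are absolutely continuous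 in $(a,b)\setminus M$, $\tau f\in L^2(a,b)$, $(*)$ holds for all $n\in I$, $[v,f]_a=0$ if $\tau_{\Lambda,R,\Theta}$ is in the limit circle case at $a$, and $[w,f]_b=0$ if it is in the limit circle case at $b$. Let $\sigma_p(H_\Lambda)$ be the set of eigenvalues of $H_\Lambda$. Let $p_n$, $n\in I$, be probability measures on $\mathbb R$ that are continuous, i.e. $p_n(\{t\})=0$ for all $t\in\mathbb R$ (they need not be identical), and let $\mathbb P_1$ be the completion of the product measure $\times_{n\in I}p_n$ on $\Omega_1=\mathbb R^I$. Let $E\in\mathbb R$, let $P_{R,\Theta}(E)=\{\Lambda\in\Omega_1: E\in\sigma_p(H_\Lambda)\}$, and let $B\subseteq P_{R,\Theta}(E)$ be measurable with respect to $\mathbb P_1$. Then $\mathbb P_1(B)=0$ or $P_{R,\Theta}(E)=\Omega_1$. -/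

import Mathlib

open MeasureTheory Filter Topology

/-- The real points strictly between two extended real numbers. -/
def eIoo (c d : EReal) : Set ℝ := {t : ℝ | c < (t : EReal) ∧ (t : EReal) < d}

/-- Real points tending to `c` from the right (this is `𝓝[>] c` for finite `c`, and `atBot` for
`c = -∞`). -/
noncomputable def atLeftEnd (c : EReal) : Filter ℝ := comap Real.toEReal (𝓝[>] c)

/-- Real points tending to `d` from the left (this is `𝓝[<] d` for finite `d`, and `atTop` for
`d = ∞`). -/
noncomputable def atRightEnd (d : EReal) : Filter ℝ := comap Real.toEReal (𝓝[<] d)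

/-- Local absolute continuity on a set: absolute continuity on each compact interval inside it. -/
def LocallyACOn (f : ℝ → ℂ) (U : Set ℝ) : Prop :=
  ∀ c d : ℝ, c ≤ d → Set.Icc c d ⊆ U → AbsolutelyContinuousOnInterval f c d

/-- The parabolic factor `P_α`. -/
def parabolicMatrix (α : ℝ) : Matrix (Fin 2) (Fin 2) ℝ := !![1, α; 0, 1]

/-- The hyperbolic factor `H_r`. -/
noncomputable def hyperbolicMatrix (r : ℝ) : Matrix (Fin 2) (Fin 2) ℝ := !![r, 0; 0, 1 / r]

/-- The elliptic factor `E_θ`. -/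
noncomputable def ellipticMatrix (θ : ℝ) : Matrix (Fin 2) (Fin 2) ℝ :=
  !![Real.cos θ, -Real.sin θ; Real.sin θ, Real.cos θ]

/-- The matrix `A_{α,r,θ} = P_α H_r E_θ`. -/
noncomputable def interactionMatrix (α r θ : ℝ) : Matrix (Fin 2) (Fin 2) ℝ :=
  parabolicMatrix α * hyperbolicMatrix r * ellipticMatrix θ

/-- The one-sided limits of `f` and `f'` at `p` exist and
`(f(p+), f'(p+))ᵀ = A (f(p-), f'(p-))ᵀ`. -/
def SatisfiesInterface (A : Matrix (Fin 2) (Fin 2) ℝ) (p : ℝ) (f : ℝ → ℂ) : Prop :=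
  ∃ l r : Fin 2 → ℂ,
    Tendsto f (𝓝[<] p) (𝓝 (l 0)) ∧ Tendsto (deriv f) (𝓝[<] p) (𝓝 (l 1)) ∧
    Tendsto f (𝓝[>] p) (𝓝 (r 0)) ∧ Tendsto (deriv f) (𝓝[>] p) (𝓝 (r 1)) ∧
    r = (A.map (fun s : ℝ => (s : ℂ))).mulVec l

/-- The Lagrange bracket `[f,g]_t`, formed with the right limits at `t`. -/
noncomputable def lagrangeBracket (f g : ℝ → ℂ) (t : ℝ) : ℂ :=
  (starRingEnd ℂ) (Function.rightLim f t) * Function.rightLim (deriv g) t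
    - (starRingEnd ℂ) (Function.rightLim (deriv f) t) * Function.rightLim g t

/-- The deterministic data: an interval `(a,b)` with `-∞ ≤ a < b ≤ ∞`, a real potential
`V ∈ L¹_loc(a,b)`, and points `x n`, `n ∈ I ⊆ ℤ`, of `(a,b)` that accumulate at most at `a`
or `b`. -/
structure PointInteractionData where
  a : EReal
  b : EReal
  a_lt_b : a < b
  V : ℝ → ℝ
  V_locallyIntegrable : LocallyIntegrableOn V (eIoo a b)
  I : Set ℤ
  x : I → ℝ
  x_mem : ∀ n, x n ∈ eIoo a b
  x_injective : Function.Injective x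
  x_discrete : ∀ t ∈ eIoo a b, ¬ AccPt t (𝓟 (Set.range x))

namespace PointInteractionData

variable (S : PointInteractionData)

/-- The set `M` of interaction points. -/
def M : Set ℝ := Set.range S.x

/-- The differential expression `τ f = -f'' + V f`. -/
noncomputable def tau (f : ℝ → ℂ) : ℝ → ℂ := fun t => -deriv (deriv f) t + (S.V t : ℂ) * f t

/-- `f` and `f'` are absolutely continuous in `(c,d) \ M`. -/
def IsRegularOn (c d : EReal) (f : ℝ → ℂ) : Prop :=
  (∀ t ∈ eIoo c d \ S.M, DifferentiableAt ℝ f t) ∧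
    LocallyACOn f (eIoo c d \ S.M) ∧ LocallyACOn (deriv f) (eIoo c d \ S.M)

/-- The interface conditions at all the points of `M` in `(c,d)`. -/
def SatisfiesInterfaces (Λ R Θ : S.I → ℝ) (c d : EReal) (f : ℝ → ℂ) : Prop :=
  ∀ n : S.I, S.x n ∈ eIoo c d →
    SatisfiesInterface (interactionMatrix (Λ n) (R n) (Θ n)) (S.x n) f

/-- `f` is a solution of `(τ_{Λ,R,Θ} - z) f = 0` on `(c,d)`. -/
def IsSolutionOn (Λ R Θ : S.I → ℝ) (z : ℂ) (c d : EReal) (f : ℝ → ℂ) : Prop :=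
  S.IsRegularOn c d f ∧
    (∀ᵐ t ∂(volume.restrict (eIoo c d)), S.tau f t - z * f t = 0) ∧
    S.SatisfiesInterfaces Λ R Θ c d f

/-- `f` is square integrable in a neighbourhood of the left endpoint `a`. -/
def LiesLeft (f : ℝ → ℂ) : Prop :=
  ∃ c ∈ eIoo S.a S.b, MemLp f 2 (volume.restrict (eIoo S.a c))

/-- `f` is square integrable in a neighbourhood of the right endpoint `b`. -/
def LiesRight (f : ℝ → ℂ) : Prop :=
  ∃ c ∈ eIoo S.a S.b, MemLp f 2 (volume.restrict (eIoo c S.b))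

def LimitCircleLeft (Λ R Θ : S.I → ℝ) : Prop :=
  ∀ (z : ℂ) (f : ℝ → ℂ), S.IsSolutionOn Λ R Θ z S.a S.b f → S.LiesLeft f

def LimitCircleRight (Λ R Θ : S.I → ℝ) : Prop :=
  ∀ (z : ℂ) (f : ℝ → ℂ), S.IsSolutionOn Λ R Θ z S.a S.b f → S.LiesRight f

def LimitPointLeft (Λ R Θ : S.I → ℝ) : Prop :=
  ∀ z : ℂ, ∃ f : ℝ → ℂ, S.IsSolutionOn Λ R Θ z S.a S.b f ∧ ¬ S.LiesLeft f

def LimitPointRight (Λ R Θ : S.I → ℝ) : Prop :=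
  ∀ z : ℂ, ∃ f : ℝ → ℂ, S.IsSolutionOn Λ R Θ z S.a S.b f ∧ ¬ S.LiesRight f

/-- Regularity at `a`: `a` is finite, `V ∈ L¹_loc[a,b)`, and `a` is not an accumulation point
of `M`. -/
def RegularLeft : Prop :=
  ∃ a₀ : ℝ, S.a = a₀ ∧ LocallyIntegrableOn S.V (insert a₀ (eIoo S.a S.b)) ∧ ¬ AccPt a₀ (𝓟 S.M)

/-- Regularity at `b`: `b` is finite, `V ∈ L¹_loc(a,b]`, and `b` is not an accumulation point
of `M`. -/
def RegularRight : Prop :=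
  ∃ b₀ : ℝ, S.b = b₀ ∧ LocallyIntegrableOn S.V (insert b₀ (eIoo S.a S.b)) ∧ ¬ AccPt b₀ (𝓟 S.M)

/-- `v` is a non-trivial real solution of `(τ_{Λ,R,Θ} - l) v = 0` near `a`, for some real `l`.
(The values of `v` at the points of `M` carry no information.) -/
def IsBoundarySolutionLeft (Λ R Θ : S.I → ℝ) (v : ℝ → ℝ) : Prop :=
  (∃ l : ℝ, ∃ c ∈ eIoo S.a S.b, S.IsSolutionOn Λ R Θ l S.a c (fun t => (v t : ℂ))) ∧
    ∃ᶠ t in atLeftEnd S.a, t ∉ S.M ∧ v t ≠ 0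

/-- `w` is a non-trivial real solution of `(τ_{Λ,R,Θ} - l) w = 0` near `b`, for some real `l`. -/
def IsBoundarySolutionRight (Λ R Θ : S.I → ℝ) (w : ℝ → ℝ) : Prop :=
  (∃ l : ℝ, ∃ c ∈ eIoo S.a S.b, S.IsSolutionOn Λ R Θ l c S.b (fun t => (w t : ℂ))) ∧
    ∃ᶠ t in atRightEnd S.b, t ∉ S.M ∧ w t ≠ 0

/-- The domain of the maximal operator `T_{Λ,R,Θ}`, described by representatives. -/
def maximalDomain (Λ R Θ : S.I → ℝ) : Set (ℝ → ℂ) :=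
  {f | MemLp f 2 (volume.restrict (eIoo S.a S.b)) ∧
    S.IsRegularOn S.a S.b f ∧
    MemLp (S.tau f) 2 (volume.restrict (eIoo S.a S.b)) ∧
    S.SatisfiesInterfaces Λ R Θ S.a S.b f}

/-- The domain of the restriction `H_{Λ,R,Θ}` of the maximal operator: the functions `f` with
`[v,f]_a = 0` in the limit circle case at `a`, and `[w,f]_b = 0` in the limit circle case
at `b`. -/
def operatorDomain (v w : ℝ → ℝ) (Λ R Θ : S.I → ℝ) : Set (ℝ → ℂ) :=
  {f | f ∈ S.maximalDomain Λ R Θ ∧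
    (S.LimitCircleLeft Λ R Θ →
      Tendsto (lagrangeBracket (fun t => (v t : ℂ)) f) (atLeftEnd S.a) (𝓝 0)) ∧
    (S.LimitCircleRight Λ R Θ →
      Tendsto (lagrangeBracket (fun t => (w t : ℂ)) f) (atRightEnd S.b) (𝓝 0))}

/-- The real eigenvalues of the operator `H_{Λ,R,Θ} f = τ f` in `L²(a,b)`. -/
def pointSpectrum (v w : ℝ → ℝ) (Λ R Θ : S.I → ℝ) : Set ℝ :=
  {E | ∃ u ∈ S.operatorDomain v w Λ R Θ,
    ¬ (u =ᵐ[volume.restrict (eIoo S.a S.b)] 0) ∧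
    S.tau u =ᵐ[volume.restrict (eIoo S.a S.b)] fun t => (E : ℂ) * u t}

/-- The set `P_{R,Θ}(E)` of the `Λ` for which `E` is an eigenvalue of `H_Λ`. -/
def eigenvalueSet (v w : ℝ → ℝ) (R Θ : S.I → ℝ) (E : ℝ) : Set (S.I → ℝ) :=
  {Λ | E ∈ S.pointSpectrum v w Λ R Θ}

end PointInteractionData

/-!
Resampling a single coordinate preserves the product measure. Hence almost every `Λ` in a set of
positive measure has the property that, for each `n`, changing the coordinate `α n` alone leads
back into the set for a non-null set of new values; as `p n` is continuous, one of them differs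
from `α n`.

Let `u` and `u'` be eigenfunctions at `E` for two parameters that differ only at `n`. On either side
of `x n` they solve the same equation and obey the same endpoint condition, so their Wronskian
vanishes there: near a regular endpoint both are proportional, to leading order, to the fixed
boundary solution, and at a limit point endpoint two linearly independent square integrable
solutions cannot exist. Thus `u` and `u'` are proportional before the interaction at `x n` and,
although the two interactions differ by a nontrivial shear, also after it. A shear fixes only the
line of vectors with vanishing second component, so `u'(x n +) = 0`, and then `u` satisfies the
interface condition at `x n` for every value of `α n`. If this holds at all `n`, the function `u`
is an eigenfunction for every `Λ`.
-/

section InfiniteProduct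

variable {ι : Type*} [DecidableEq ι] {X : ι → Type*}

theorem preimage_update_pi_of_mem {s : Finset ι} {n : ι} (hn : n ∈ s) (t : ∀ i, Set (X i)) :
    (fun y : (∀ i, X i) × X n => Function.update y.1 n y.2) ⁻¹' (Set.pi s t) =
      Set.pi (s.erase n) t ×ˢ t n := by
  ext y
  simp only [Set.mem_preimage, Set.mem_pi, Set.mem_prod, Finset.mem_coe, Finset.mem_erase]
  refine ⟨fun h => ⟨fun i hi => ?_, ?_⟩, fun ⟨h, hn'⟩ i hi => ?_⟩
  · exact Function.update_of_ne hi.1 y.2 y.1 ▸ h i hi.2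
  · exact Function.update_self n y.2 y.1 ▸ h n hn
  · rcases eq_or_ne i n with rfl | hin
    · rwa [Function.update_self]
    · rw [Function.update_of_ne hin]
      exact h i ⟨hin, hi⟩

theorem preimage_update_pi_of_notMem {s : Finset ι} {n : ι} (hn : n ∉ s) (t : ∀ i, Set (X i)) :
    (fun y : (∀ i, X i) × X n => Function.update y.1 n y.2) ⁻¹' (Set.pi s t) =
      Set.pi s t ×ˢ Set.univ := by
  ext y
  simp only [Set.mem_preimage, Set.mem_pi, Set.mem_prod, Finset.mem_coe, Set.mem_univ, and_true]
  exact forall₂_congr fun i hi => by rw [Function.update_of_ne (ne_of_mem_of_not_mem hi hn)]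

variable [∀ i, MeasurableSpace (X i)] (μ : ∀ i, Measure (X i)) [∀ i, IsProbabilityMeasure (μ i)]

theorem measurePreserving_update_infinitePi (n : ι) :
    MeasurePreserving (fun y : (∀ i, X i) × X n => Function.update y.1 n y.2)
      ((Measure.infinitePi μ).prod (μ n)) (Measure.infinitePi μ) := by
  have hmeas : Measurable fun y : (∀ i, X i) × X n => Function.update y.1 n y.2 :=
    measurable_update'
  refine ⟨hmeas, Measure.eq_infinitePi μ fun s t ht => ?_⟩
  rw [Measure.map_apply hmeas (MeasurableSet.pi s.countable_toSet fun i _ => ht i)]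
  by_cases hn : n ∈ s
  · rw [preimage_update_pi_of_mem hn, Measure.prod_prod, Measure.infinitePi_pi _ fun i _ => ht i,
      Finset.prod_erase_mul _ _ hn]
  · rw [preimage_update_pi_of_notMem hn, Measure.prod_prod,
      Measure.infinitePi_pi _ fun i _ => ht i, measure_univ, mul_one]

theorem ae_frequently_update_mem (n : ι) {B : Set (∀ i, X i)} (hB : MeasurableSet B) :
    ∀ᵐ x ∂Measure.infinitePi μ, x ∈ B → ∃ᶠ t in ae (μ n), Function.update x n t ∈ B := by
  have hT := measurePreserving_update_infinitePi μ n
  have hmeas : Measurable fun x : ∀ i, X i => μ n {t | Function.update x n t ∈ B} :=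
    measurable_measure_prodMk_left (hT.measurable hB)
  set N : Set (∀ i, X i) := B ∩ {x | μ n {t | Function.update x n t ∈ B} = 0}
  have hN : MeasurableSet N := hB.inter (hmeas (measurableSet_singleton 0))
  have hslice (x : ∀ i, X i) : μ n {t | Function.update x n t ∈ N} = 0 := by
    rcases Set.eq_empty_or_nonempty {t | Function.update x n t ∈ N} with h | ⟨t, -, ht⟩
    · rw [h, measure_empty]
    · simp only [Set.mem_ofPred_eq, Function.update_idem] at ht
      exact measure_mono_null (fun s hs => hs.1) ht
  have hN0 : Measure.infinitePi μ N = 0 := by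
    rw [← hT.measure_preimage hN.nullMeasurableSet, Measure.measure_prod_null (hT.measurable hN)]
    exact Eventually.of_forall hslice
  filter_upwards [measure_eq_zero_iff_ae_notMem.1 hN0] with x hx hxB
  rw [frequently_ae_iff]
  exact fun h0 => hx ⟨hxB, h0⟩

theorem exists_forall_update_mem [Countable ι] [∀ i, NullSingletonClass (μ i)] {B : Set (∀ i, X i)}
    (hB : NullMeasurableSet B (Measure.infinitePi μ)) (hB0 : Measure.infinitePi μ B ≠ 0) :
    ∃ x ∈ B, ∀ n, ∃ t, t ≠ x n ∧ Function.update x n t ∈ B := by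
  obtain ⟨B', hB'B, hB', hae⟩ := hB.exists_measurable_subset_ae_eq
  have hall : ∀ᵐ x ∂Measure.infinitePi μ, ∀ n, x ∈ B' →
      ∃ᶠ t in ae (μ n), Function.update x n t ∈ B' :=
    ae_all_iff.2 fun n => ae_frequently_update_mem μ n hB'
  have hfreq : ∃ᶠ x in ae (Measure.infinitePi μ), x ∈ B' :=
    frequently_ae_mem_iff.2 (by rwa [measure_congr hae])
  obtain ⟨x, hxB', hx⟩ := (hfreq.and_eventually hall).exists
  refine ⟨x, hB'B hxB', fun n => ?_⟩
  have hne : ∀ᵐ t ∂μ n, t ≠ x n := measure_eq_zero_iff_ae_notMem.1 (measure_singleton (x n))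
  obtain ⟨t, ht, htx⟩ := ((hx n hxB').and_eventually hne).exists
  exact ⟨t, htx, hB'B ht⟩

end InfiniteProduct

section AbsoluteContinuity

theorem absolutelyContinuousOnInterval_comp {X Y : Type*} [PseudoMetricSpace X]
    [PseudoMetricSpace Y] {φ : X → Y} {f : ℝ → X} {a b : ℝ} {K : NNReal}
    (hφ : LipschitzOnWith K φ (f '' Set.uIcc a b)) (hf : AbsolutelyContinuousOnInterval f a b) :
    AbsolutelyContinuousOnInterval (fun t => φ (f t)) a b := by
  rw [absolutelyContinuousOnInterval_iff] at hf ⊢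
  intro ε hε
  obtain ⟨δ, hδ, hsum⟩ := hf (ε / (K + 1)) (by positivity)
  refine ⟨δ, hδ, fun P hP hPδ => ?_⟩
  calc ∑ i ∈ Finset.range P.1, dist (φ (f (P.2 i).1)) (φ (f (P.2 i).2))
      ≤ ∑ i ∈ Finset.range P.1, K * dist (f (P.2 i).1) (f (P.2 i).2) :=
        Finset.sum_le_sum fun i hi => hφ.dist_le_mul _ (Set.mem_image_of_mem f (hP.1 i hi).1) _
          (Set.mem_image_of_mem f (hP.1 i hi).2)
    _ = K * ∑ i ∈ Finset.range P.1, dist (f (P.2 i).1) (f (P.2 i).2) := by rw [Finset.mul_sum]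
    _ ≤ K * (ε / (K + 1)) := by gcongr; exact (hsum P hP hPδ).le
    _ < (K + 1) * (ε / (K + 1)) := by gcongr; linarith
    _ = ε := by field

theorem absolutelyContinuousOnInterval_norm {E : Type*} [SeminormedAddCommGroup E] {f : ℝ → E}
    {a b : ℝ} (hf : AbsolutelyContinuousOnInterval f a b) :
    AbsolutelyContinuousOnInterval (fun t => ‖f t‖) a b :=
  absolutelyContinuousOnInterval_comp lipschitzWith_one_norm.lipschitzOnWith hf

theorem absolutelyContinuousOnInterval_exp {f : ℝ → ℝ} {a b : ℝ}
    (hf : AbsolutelyContinuousOnInterval f a b) :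
    AbsolutelyContinuousOnInterval (fun t => Real.exp (f t)) a b := by
  obtain ⟨K, hK⟩ := Real.contDiff_exp.contDiffOn.exists_lipschitzOnWith one_ne_zero
    (convex_uIcc (sInf (f '' Set.uIcc a b)) (sSup (f '' Set.uIcc a b))) isCompact_uIcc
  rw [← hf.continuousOn.image_uIcc] at hK
  exact absolutelyContinuousOnInterval_comp hK hf

theorem abs_deriv_norm_le_norm_deriv {E : Type*} [NormedAddCommGroup E] [NormedSpace ℝ E]
    {f : ℝ → E} {x : ℝ} (hf : DifferentiableAt ℝ f x) :
    |deriv (fun t => ‖f t‖) x| ≤ ‖deriv f x‖ := by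
  by_cases hn : DifferentiableAt ℝ (fun t => ‖f t‖) x
  · refine le_of_tendsto_of_tendsto hn.hasDerivAt.tendsto_slope.abs
      hf.hasDerivAt.tendsto_slope.norm (Eventually.of_forall fun y => ?_)
    simp only [slope_def_module, norm_smul, smul_eq_mul, abs_mul, Real.norm_eq_abs]
    gcongr
    exact abs_norm_sub_norm_le _ _
  · rw [deriv_zero_of_not_differentiableAt hn, abs_zero]
    exact norm_nonneg _

theorem le_mul_exp_integral_of_deriv_le_mul {N k : ℝ → ℝ} {s t : ℝ} (hst : s ≤ t)
    (hN : AbsolutelyContinuousOnInterval N s t) (hk : IntervalIntegrable k volume s t)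
    (hle : ∀ᵐ x, x ∈ Set.uIcc s t → deriv N x ≤ k x * N x) :
    N t ≤ N s * Real.exp (∫ x in s..t, k x) := by
  set G : ℝ → ℝ := fun x => N x * Real.exp (-∫ y in s..x, k y) with hG
  have hGac : AbsolutelyContinuousOnInterval G s t :=
    hN.fun_mul (absolutelyContinuousOnInterval_exp
      (hk.absolutelyContinuousOnInterval_intervalIntegral Set.left_mem_uIcc).neg)
  have hG' : ∀ᵐ x, x ∈ Set.Icc s t → deriv G x ≤ 0 := by
    rw [← Set.uIcc_of_le hst]
    filter_upwards [hN.ae_differentiableAt, hk.ae_hasDerivAt_integral, hle] with x hNx hkx hlex hx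
    rw [((hNx hx).hasDerivAt.fun_mul (hkx hx s Set.left_mem_uIcc).fun_neg.exp).deriv]
    have := mul_nonneg (sub_nonneg.2 (hlex hx)) (Real.exp_nonneg (-∫ y in s..x, k y))
    linarith
  have hGst : G t - G s ≤ 0 := by
    rw [← hGac.integral_deriv_eq_sub, intervalIntegral.integral_of_le hst]
    refine integral_nonpos_of_ae ?_
    rw [EventuallyLE, ae_restrict_iff' measurableSet_Ioc]
    filter_upwards [hG'] with x hx hxm using hx (Set.Ioc_subset_Icc_self hxm)
  have hGs : G s = N s := by simp [hG]
  rw [hGs, sub_nonpos] at hGst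
  simp only [hG, Real.exp_neg, ← div_eq_mul_inv] at hGst
  rwa [div_le_iff₀ (Real.exp_pos _)] at hGst

theorem le_mul_exp_abs_integral_of_abs_deriv_le_mul {N k : ℝ → ℝ} {s t : ℝ}
    (hN : AbsolutelyContinuousOnInterval N s t) (hk : IntervalIntegrable k volume s t)
    (hle : ∀ᵐ x, x ∈ Set.uIcc s t → |deriv N x| ≤ k x * N x) (hNs : 0 ≤ N s) :
    N t ≤ N s * Real.exp |∫ x in s..t, k x| := by
  rcases le_total s t with hst | hts
  · refine (le_mul_exp_integral_of_deriv_le_mul hst hN hk ?_).trans ?_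
    · filter_upwards [hle] with x hx hxm using (le_abs_self _).trans (hx hxm)
    · gcongr
      exact le_abs_self _
  · have hback : -N s ≤ -N t * Real.exp (∫ x in t..s, -k x) := by
      refine le_mul_exp_integral_of_deriv_le_mul hts hN.symm.fun_neg hk.symm.neg ?_
      rw [Set.uIcc_comm]
      filter_upwards [hle] with x hx hxm
      rw [deriv.fun_neg, neg_mul_neg]
      exact (neg_le_abs _).trans (hx hxm)
    rw [intervalIntegral.integral_neg, intervalIntegral.integral_symm, neg_neg, neg_mul,
      neg_le_neg_iff, ← le_div_iff₀ (Real.exp_pos _), div_eq_mul_inv, ← Real.exp_neg] at hback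
    refine hback.trans ?_
    gcongr
    exact neg_le_abs _

end AbsoluteContinuity

section SymplecticForm

/-- The standard symplectic form on the plane; on initial data it is the Wronskian. -/
def symplecticForm {R : Type*} [CommRing R] (y z : Fin 2 → R) : R := y 0 * z 1 - y 1 * z 0

theorem symplecticForm_mulVec {R : Type*} [CommRing R] (A : Matrix (Fin 2) (Fin 2) R)
    (y z : Fin 2 → R) :
    symplecticForm (A.mulVec y) (A.mulVec z) = A.det * symplecticForm y z := by
  simp only [symplecticForm, Matrix.mulVec, dotProduct, Fin.sum_univ_two, Matrix.det_fin_two]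
  ring

theorem symplecticForm_smul {R : Type*} [CommRing R] (y z w : Fin 2 → R) :
    symplecticForm y z • w = symplecticForm w z • y - symplecticForm w y • z := by
  ext i
  fin_cases i <;> simp [symplecticForm] <;> ring

theorem tendsto_symplecticForm {R X : Type*} [CommRing R] [TopologicalSpace R]
    [IsTopologicalRing R] {l : Filter X} {f g : X → Fin 2 → R} {y z : Fin 2 → R}
    (hf : Tendsto f l (𝓝 y)) (hg : Tendsto g l (𝓝 z)) :
    Tendsto (fun x => symplecticForm (f x) (g x)) l (𝓝 (symplecticForm y z)) :=
  ((hf.apply_nhds 0).mul (hg.apply_nhds 1)).sub ((hf.apply_nhds 1).mul (hg.apply_nhds 0))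

theorem eq_zero_of_tendsto_symplecticForm {X 𝕜 : Type*} [NormedField 𝕜] {l : Filter X} [l.NeBot]
    {y z w : X → Fin 2 → 𝕜} {C : 𝕜} (hC : ∀ᶠ s in l, symplecticForm (y s) (z s) = C)
    (hy : y =O[l] fun _ => (1 : ℝ)) (hz : z =O[l] fun _ => (1 : ℝ))
    (hw : (fun _ => (1 : ℝ)) =O[l] w)
    (hwy : Tendsto (fun s => symplecticForm (w s) (y s)) l (𝓝 0))
    (hwz : Tendsto (fun s => symplecticForm (w s) (z s)) l (𝓝 0)) : C = 0 := by
  have hCw : (fun s => C • w s) =o[l] fun _ => (1 : ℝ) := by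
    have hdecomp := (((Asymptotics.isLittleO_one_iff ℝ).2 hwz).smul_isBigO hy).sub
      (((Asymptotics.isLittleO_one_iff ℝ).2 hwy).smul_isBigO hz)
    refine hdecomp.congr' ?_ (.of_eq (funext fun _ => mul_one 1))
    filter_upwards [hC] with s hs
    rw [← hs]
    exact (symplecticForm_smul _ _ _).symm
  have hCo : (fun _ => C) =o[l] fun _ : X => (1 : ℝ) := by
    refine Asymptotics.IsBigO.trans_isLittleO ?_ hCw
    simpa using ((Asymptotics.isBigO_refl (fun _ : X => C) l).norm_left.smul hw).norm_left
  exact tendsto_nhds_unique tendsto_const_nhds ((Asymptotics.isLittleO_one_iff ℝ).1 hCo)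

end SymplecticForm

section InteractionMatrix

variable {α β r θ : ℝ}

theorem parabolicMatrix_mul_interactionMatrix (α β r θ : ℝ) :
    parabolicMatrix α * interactionMatrix β r θ = interactionMatrix (β + α) r θ := by
  have hadd : parabolicMatrix α * parabolicMatrix β = parabolicMatrix (β + α) := by
    simp [parabolicMatrix]
  rw [interactionMatrix, interactionMatrix, ← hadd]
  simp only [Matrix.mul_assoc]

theorem det_interactionMatrix (α θ : ℝ) (hr : r ≠ 0) : (interactionMatrix α r θ).det = 1 := by
  have hθ : (ellipticMatrix θ).det = 1 := by
    rw [ellipticMatrix, Matrix.det_fin_two_of]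
    linear_combination Real.cos_sq_add_sin_sq θ
  rw [interactionMatrix, Matrix.det_mul, Matrix.det_mul, hθ]
  simp [parabolicMatrix, hyperbolicMatrix, Matrix.det_fin_two_of, mul_inv_cancel₀ hr]

theorem det_map_ofReal (A : Matrix (Fin 2) (Fin 2) ℝ) :
    (A.map Complex.ofReal).det = (A.det : ℂ) :=
  (Complex.ofRealHom.map_det A).symm

theorem interactionMatrix_mulVec (α β r θ : ℝ) (y : Fin 2 → ℂ) :
    ((interactionMatrix (β + α) r θ).map Complex.ofReal).mulVec y =
      ((parabolicMatrix α).map Complex.ofReal).mulVec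
        (((interactionMatrix β r θ).map Complex.ofReal).mulVec y) := by
  rw [Matrix.mulVec_mulVec, ← parabolicMatrix_mul_interactionMatrix]
  exact congrArg (Matrix.mulVec · y) (Matrix.map_mul (f := Complex.ofRealHom))

theorem parabolicMatrix_mulVec (α : ℝ) (y : Fin 2 → ℂ) :
    ((parabolicMatrix α).map Complex.ofReal).mulVec y = ![y 0 + α * y 1, y 1] := by
  ext i
  fin_cases i <;> simp [parabolicMatrix, Matrix.mulVec, dotProduct, Fin.sum_univ_two]

theorem apply_one_eq_zero_of_symplecticForm_parabolicMatrix (hα : α ≠ 0) {y z : Fin 2 → ℂ}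
    (hyz : symplecticForm y z = 0)
    (hshear : symplecticForm y (((parabolicMatrix α).map Complex.ofReal).mulVec z) = 0)
    (hz : z ≠ 0) : y 1 = 0 := by
  rw [parabolicMatrix_mulVec] at hshear
  simp only [symplecticForm, Matrix.cons_val_zero, Matrix.cons_val_one] at hyz hshear
  have hprod : y 1 * z 1 = 0 := by
    refine (mul_eq_zero.1 ?_).resolve_left (Complex.ofReal_ne_zero.2 hα)
    linear_combination hyz - hshear
  by_contra hy
  have hz1 : z 1 = 0 := (mul_eq_zero.1 hprod).resolve_left hy
  have hz0 : z 0 = 0 := (mul_eq_zero.1 (by simpa [hz1] using hyz)).resolve_left hy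
  exact hz (funext (Fin.forall_fin_two.2 ⟨hz0, hz1⟩))

theorem apply_one_eq_zero_of_symplecticForm_interactionMatrix (hαβ : α ≠ β)
    {y z : Fin 2 → ℂ} (hyz : symplecticForm y z = 0)
    (hyz' : symplecticForm (((interactionMatrix α r θ).map Complex.ofReal).mulVec y)
      (((interactionMatrix β r θ).map Complex.ofReal).mulVec z) = 0)
    (hz : ((interactionMatrix β r θ).map Complex.ofReal).mulVec z ≠ 0) :
    (((interactionMatrix α r θ).map Complex.ofReal).mulVec y) 1 = 0 := by
  rw [← add_sub_cancel α β, interactionMatrix_mulVec] at hyz' hz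
  refine apply_one_eq_zero_of_symplecticForm_parabolicMatrix (sub_ne_zero.2 hαβ.symm) ?_ hyz'
    fun h => hz (by rw [h, Matrix.mulVec_zero])
  rw [symplecticForm_mulVec, hyz, mul_zero]

end InteractionMatrix

section Jet

/-- The initial data `(f(t+), f'(t+))`. -/
noncomputable def jet (f : ℝ → ℂ) (t : ℝ) : Fin 2 → ℂ :=
  ![Function.rightLim f t, Function.rightLim (deriv f) t]

variable {f : ℝ → ℂ} {t : ℝ}

theorem jet_eq_of_continuousAt (hf : ContinuousAt f t) (hf' : ContinuousAt (deriv f) t) :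
    jet f t = ![f t, deriv f t] := by
  rw [jet, hf.continuousWithinAt.rightLim_eq, hf'.continuousWithinAt.rightLim_eq]

theorem lagrangeBracket_ofReal {v : ℝ → ℝ} {g : ℝ → ℂ}
    (hv : ContinuousAt (fun s => (v s : ℂ)) t) (hv' : ContinuousAt (deriv fun s => (v s : ℂ)) t) :
    lagrangeBracket (fun s => (v s : ℂ)) g t =
      symplecticForm (jet (fun s => (v s : ℂ)) t) (jet g t) := by
  have hconj : (starRingEnd ℂ) (deriv (fun s => (v s : ℂ)) t) = deriv (fun s => (v s : ℂ)) t := by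
    rw [starRingEnd_apply, ← deriv.star]
    simp only [RCLike.star_def, Complex.conj_ofReal]
  rw [lagrangeBracket, jet_eq_of_continuousAt hv hv', hv.continuousWithinAt.rightLim_eq,
    hv'.continuousWithinAt.rightLim_eq, Complex.conj_ofReal, hconj]
  rfl

theorem satisfiesInterface_one (hf : ContinuousAt f t) (hf' : ContinuousAt (deriv f) t) :
    SatisfiesInterface 1 t f :=
  ⟨![f t, deriv f t], ![f t, deriv f t], hf.mono_left nhdsWithin_le_nhds,
    hf'.mono_left nhdsWithin_le_nhds, hf.mono_left nhdsWithin_le_nhds,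
    hf'.mono_left nhdsWithin_le_nhds, by simp⟩

theorem SatisfiesInterface.exists_tendsto {A : Matrix (Fin 2) (Fin 2) ℝ}
    (h : SatisfiesInterface A t f) :
    ∃ y, Tendsto (fun s => ![f s, deriv f s]) (𝓝[<] t) (𝓝 y) ∧
      Tendsto (fun s => ![f s, deriv f s]) (𝓝[>] t) (𝓝 (jet f t)) ∧
      jet f t = (A.map Complex.ofReal).mulVec y := by
  obtain ⟨y, z, hy0, hy1, hz0, hz1, hyz⟩ := h
  have hjet : jet f t = z :=
    funext (Fin.forall_fin_two.2 ⟨rightLim_eq_of_tendsto hz0, rightLim_eq_of_tendsto hz1⟩)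
  exact ⟨y, tendsto_pi_nhds.2 (Fin.forall_fin_two.2 ⟨hy0, hy1⟩),
    hjet ▸ tendsto_pi_nhds.2 (Fin.forall_fin_two.2 ⟨hz0, hz1⟩), hjet.trans hyz⟩

theorem SatisfiesInterface.of_jet_one_eq_zero {α r θ : ℝ}
    (h : SatisfiesInterface (interactionMatrix α r θ) t f) (h0 : jet f t 1 = 0) (β : ℝ) :
    SatisfiesInterface (interactionMatrix β r θ) t f := by
  obtain ⟨y, z, hy0, hy1, hz0, hz1, hyz⟩ := h
  refine ⟨y, z, hy0, hy1, hz0, hz1, ?_⟩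
  have hz : z 1 = 0 := (rightLim_eq_of_tendsto hz1).symm.trans h0
  rw [← add_sub_cancel α β, interactionMatrix_mulVec, ← hyz, parabolicMatrix_mulVec, hz, mul_zero,
    add_zero]
  exact funext (Fin.forall_fin_two.2 ⟨rfl, hz⟩)

end Jet

theorem LocallyACOn.absolutelyContinuousOnInterval {f : ℝ → ℂ} {U : Set ℝ}
    (hf : LocallyACOn f U) {s t : ℝ} (h : Set.uIcc s t ⊆ U) :
    AbsolutelyContinuousOnInterval f s t := by
  rcases le_total s t with hst | hts
  · exact hf s t hst (Set.uIcc_of_le hst ▸ h)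
  · exact (hf t s hts (Set.uIcc_of_ge hts ▸ h)).symm

theorem LocallyACOn.mono {f : ℝ → ℂ} {U U' : Set ℝ} (hf : LocallyACOn f U) (h : U' ⊆ U) :
    LocallyACOn f U' :=
  fun c d hcd hsub => hf c d hcd (hsub.trans h)

/-- `f` is a Carathéodory solution of `f'' = q f` on `U`: differentiable with `f` and `f'` locally
absolutely continuous, the equation holding almost everywhere. -/
structure IsCaratheodorySolution (q : ℝ → ℂ) (U : Set ℝ) (f : ℝ → ℂ) : Prop where
  differentiableAt : ∀ t ∈ U, DifferentiableAt ℝ f t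
  ac : LocallyACOn f U
  ac_deriv : LocallyACOn (deriv f) U
  ae_eq : ∀ᵐ t, t ∈ U → deriv (deriv f) t = q t * f t

namespace IsCaratheodorySolution

variable {q : ℝ → ℂ} {U U' : Set ℝ} {f g : ℝ → ℂ} {a b s t : ℝ} {l : Filter ℝ} {y z : Fin 2 → ℂ}

theorem mono (hf : IsCaratheodorySolution q U f) (h : U' ⊆ U) : IsCaratheodorySolution q U' f where
  differentiableAt t ht := hf.differentiableAt t (h ht)
  ac := hf.ac.mono h
  ac_deriv := hf.ac_deriv.mono h
  ae_eq := by filter_upwards [hf.ae_eq] with t ht htU using ht (h htU)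

theorem continuousAt_deriv (hf : IsCaratheodorySolution q U f) (hU : U ∈ 𝓝 t) :
    ContinuousAt (deriv f) t := by
  obtain ⟨ε, hε, h⟩ := Metric.nhds_basis_closedBall.mem_iff.1 hU
  rw [Real.closedBall_eq_Icc] at h
  have hac := (hf.ac_deriv _ _ (by linarith) h).continuousOn
  rw [Set.uIcc_of_le (by linarith)] at hac
  exact hac.continuousAt (Icc_mem_nhds (by linarith) (by linarith))

theorem ae_hasDerivAt_deriv (hf : IsCaratheodorySolution q U f) (h : Set.uIcc s t ⊆ U) :
    ∀ᵐ x, x ∈ Set.uIcc s t → HasDerivAt (deriv f) (q x * f x) x := by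
  filter_upwards [hf.ae_eq, (hf.ac_deriv.absolutelyContinuousOnInterval
    h).boundedVariationOn.ae_differentiableAt_of_mem_uIcc] with x hx hdx hxm
  exact hx (h hxm) ▸ (hdx hxm).hasDerivAt

theorem wronskian_eq (hf : IsCaratheodorySolution q U f) (hg : IsCaratheodorySolution q U g)
    (h : Set.uIcc s t ⊆ U) :
    f s * deriv g s - deriv f s * g s = f t * deriv g t - deriv f t * g t := by
  have ac_of {k : ℝ → ℂ} (hk : LocallyACOn k U) : AbsolutelyContinuousOnInterval k s t :=
    hk.absolutelyContinuousOnInterval h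
  have hac : AbsolutelyContinuousOnInterval (fun x => f x • deriv g x - deriv f x • g x) s t :=
    ((ac_of hf.ac).fun_smul (ac_of hg.ac_deriv)).sub ((ac_of hf.ac_deriv).fun_smul (ac_of hg.ac))
  obtain ⟨C, hC⟩ := hac.const_of_ae_hasDerivAt_zero (by
    filter_upwards [hf.ae_hasDerivAt_deriv h, hg.ae_hasDerivAt_deriv h] with x hfx hgx hx
    have hW := ((hf.differentiableAt x (h hx)).hasDerivAt.fun_smul (hgx hx)).fun_sub
      ((hfx hx).fun_smul (hg.differentiableAt x (h hx)).hasDerivAt)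
    convert! hW using 1
    simp only [smul_eq_mul]
    ring)
  exact (hC s Set.left_mem_uIcc).trans (hC t Set.right_mem_uIcc).symm

theorem norm_add_norm_deriv_le (hf : IsCaratheodorySolution q U f) (h : Set.uIcc s t ⊆ U)
    (hq : IntervalIntegrable q volume s t) :
    ‖f t‖ + ‖deriv f t‖ ≤ (‖f s‖ + ‖deriv f s‖) * Real.exp |∫ x in s..t, (1 + ‖q x‖)| := by
  have hNf := absolutelyContinuousOnInterval_norm
    (hf.ac.absolutelyContinuousOnInterval h)
  have hNf' := absolutelyContinuousOnInterval_norm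
    (hf.ac_deriv.absolutelyContinuousOnInterval h)
  refine le_mul_exp_abs_integral_of_abs_deriv_le_mul (N := fun x => ‖f x‖ + ‖deriv f x‖)
    (k := fun x => 1 + ‖q x‖) (hNf.fun_add hNf')
    (intervalIntegrable_const.add hq.norm) ?_ (by positivity)
  filter_upwards [hf.ae_hasDerivAt_deriv h, hNf.ae_differentiableAt, hNf'.ae_differentiableAt]
    with x hfx hNx hNx' hx
  have h1 := abs_deriv_norm_le_norm_deriv (hf.differentiableAt x (h hx))
  have h2 := abs_deriv_norm_le_norm_deriv (hfx hx).differentiableAt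
  rw [(hfx hx).deriv, norm_mul] at h2
  rw [deriv_fun_add (hNx hx) (hNx' hx)]
  calc |deriv (fun t => ‖f t‖) x + deriv (fun t => ‖deriv f t‖) x|
      ≤ ‖deriv f x‖ + ‖q x‖ * ‖f x‖ := (abs_add_le _ _).trans (add_le_add h1 h2)
    _ ≤ (1 + ‖q x‖) * (‖f x‖ + ‖deriv f x‖) := by
        nlinarith [norm_nonneg (f x), norm_nonneg (q x), norm_nonneg (deriv f x),
          mul_nonneg (norm_nonneg (q x)) (norm_nonneg (deriv f x))]

theorem exists_norm_le (hf : IsCaratheodorySolution q (Set.Ioo a b) f)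
    (hq : IntegrableOn q (Set.Ioo a b)) :
    ∃ C, ∀ s ∈ Set.Ioo a b, ∀ t ∈ Set.Ioo a b,
      ‖![f t, deriv f t]‖ ≤ C * ‖![f s, deriv f s]‖ := by
  have hk : IntegrableOn (fun x => 1 + ‖q x‖) (Set.Ioo a b) :=
    (integrableOn_const (by simp)).add hq.norm
  refine ⟨Real.exp (∫ x in Set.Ioo a b, (1 + ‖q x‖)) * 2, fun s hs t ht => ?_⟩
  have hsub : Set.uIcc s t ⊆ Set.Ioo a b := Set.OrdConnected.uIcc_subset inferInstance hs ht
  have hint : |∫ x in s..t, (1 + ‖q x‖)| ≤ ∫ x in Set.Ioo a b, (1 + ‖q x‖) := by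
    rw [intervalIntegral.abs_integral_eq_abs_integral_uIoc, abs_of_nonneg (by positivity)]
    exact setIntegral_mono_set hk (ae_of_all _ fun x => by positivity)
      (Set.uIoc_subset_uIcc.trans hsub).eventuallyLE
  calc ‖![f t, deriv f t]‖ ≤ ‖f t‖ + ‖deriv f t‖ := by
        rw [pi_norm_le_iff_of_nonneg (by positivity), Fin.forall_fin_two]
        exact ⟨le_add_of_nonneg_right (norm_nonneg _), le_add_of_nonneg_left (norm_nonneg _)⟩
    _ ≤ (‖f s‖ + ‖deriv f s‖) * Real.exp |∫ x in s..t, (1 + ‖q x‖)| :=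
        hf.norm_add_norm_deriv_le hsub ((hq.mono_set hsub).intervalIntegrable)
    _ ≤ (‖![f s, deriv f s]‖ + ‖![f s, deriv f s]‖)
          * Real.exp (∫ x in Set.Ioo a b, (1 + ‖q x‖)) := by
        gcongr
        · exact norm_le_pi_norm ![f s, deriv f s] 0
        · exact norm_le_pi_norm ![f s, deriv f s] 1
    _ = _ := by ring

theorem jet_eq (hf : IsCaratheodorySolution q U f) (hU : U ∈ 𝓝 t) : jet f t = ![f t, deriv f t] :=
  jet_eq_of_continuousAt (hf.differentiableAt t (mem_of_mem_nhds hU)).continuousAt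
    (hf.continuousAt_deriv hU)

theorem jet_eqOn (hf : IsCaratheodorySolution q U f) (hU : IsOpen U) :
    Set.EqOn (jet f) (fun t => ![f t, deriv f t]) U :=
  fun _ ht => hf.jet_eq (hU.mem_nhds ht)

theorem symplecticForm_jet_eq (hf : IsCaratheodorySolution q (Set.Ioo a b) f)
    (hg : IsCaratheodorySolution q (Set.Ioo a b) g) (hs : s ∈ Set.Ioo a b)
    (ht : t ∈ Set.Ioo a b) :
    symplecticForm (jet f s) (jet g s) = symplecticForm (jet f t) (jet g t) := by
  rw [hf.jet_eqOn isOpen_Ioo hs, hf.jet_eqOn isOpen_Ioo ht, hg.jet_eqOn isOpen_Ioo hs,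
    hg.jet_eqOn isOpen_Ioo ht]
  exact hf.wronskian_eq hg (Set.OrdConnected.uIcc_subset inferInstance hs ht)

theorem exists_norm_jet_le (hf : IsCaratheodorySolution q (Set.Ioo a b) f)
    (hq : IntegrableOn q (Set.Ioo a b)) :
    ∃ C, ∀ s ∈ Set.Ioo a b, ∀ t ∈ Set.Ioo a b, ‖jet f t‖ ≤ C * ‖jet f s‖ := by
  obtain ⟨C, hC⟩ := hf.exists_norm_le hq
  refine ⟨C, fun s hs t ht => ?_⟩
  rw [hf.jet_eqOn isOpen_Ioo hs, hf.jet_eqOn isOpen_Ioo ht]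
  exact hC s hs t ht

theorem isBigO_jet_one (hf : IsCaratheodorySolution q (Set.Ioo a b) f)
    (hq : IntegrableOn q (Set.Ioo a b)) (hs : s ∈ Set.Ioo a b) (hl : Set.Ioo a b ∈ l) :
    jet f =O[l] fun _ => (1 : ℝ) := by
  obtain ⟨C, hC⟩ := hf.exists_norm_jet_le hq
  refine .of_bound (C * ‖jet f s‖) ?_
  filter_upwards [hl] with t ht
  rw [norm_one, mul_one]
  exact hC s hs t ht

theorem isBigO_one_jet (hf : IsCaratheodorySolution q (Set.Ioo a b) f)
    (hq : IntegrableOn q (Set.Ioo a b)) (hs : s ∈ Set.Ioo a b) (hfs : jet f s ≠ 0)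
    (hl : Set.Ioo a b ∈ l) : (fun _ => (1 : ℝ)) =O[l] jet f := by
  obtain ⟨C, hC⟩ := hf.exists_norm_jet_le hq
  refine .of_bound (C / ‖jet f s‖) ?_
  filter_upwards [hl] with t ht
  rw [norm_one, div_mul_eq_mul_div, one_le_div (norm_pos_iff.2 hfs)]
  exact hC t ht s hs

theorem symplecticForm_jet_eq_of_tendsto [l.NeBot]
    (hf : IsCaratheodorySolution q (Set.Ioo a b) f) (hg : IsCaratheodorySolution q (Set.Ioo a b) g)
    (hs : s ∈ Set.Ioo a b) (hl : Set.Ioo a b ∈ l) (hy : Tendsto (jet f) l (𝓝 y))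
    (hz : Tendsto (jet g) l (𝓝 z)) : symplecticForm (jet f s) (jet g s) = symplecticForm y z := by
  refine tendsto_nhds_unique (tendsto_const_nhds.congr' ?_) (tendsto_symplecticForm hy hz)
  filter_upwards [hl] with t ht using hf.symplecticForm_jet_eq hg hs ht

theorem jet_eq_zero_iff_of_tendsto [l.NeBot] (hf : IsCaratheodorySolution q (Set.Ioo a b) f)
    (hq : IntegrableOn q (Set.Ioo a b)) (hs : s ∈ Set.Ioo a b) (hl : Set.Ioo a b ∈ l)
    (hy : Tendsto (jet f) l (𝓝 y)) : jet f s = 0 ↔ y = 0 := by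
  obtain ⟨C, hC⟩ := hf.exists_norm_jet_le hq
  have hyle : ‖y‖ ≤ C * ‖jet f s‖ := le_of_tendsto hy.norm (by
    filter_upwards [hl] with t ht using hC s hs t ht)
  have hley : ‖jet f s‖ ≤ C * ‖y‖ := ge_of_tendsto (hy.norm.const_mul C) (by
    filter_upwards [hl] with t ht using hC t ht s hs)
  constructor <;> rintro h
  · rwa [h, norm_zero, mul_zero, norm_le_zero_iff] at hyle
  · rwa [h, norm_zero, mul_zero, norm_le_zero_iff] at hley

theorem memLp (hf : IsCaratheodorySolution q (Set.Ioo a b) f) (hq : IntegrableOn q (Set.Ioo a b))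
    (p : ENNReal) : MemLp f p (volume.restrict (Set.Ioo a b)) := by
  rcases Set.eq_empty_or_nonempty (Set.Ioo a b) with h | ⟨s, hs⟩
  · simp [h]
  obtain ⟨C, hC⟩ := hf.exists_norm_le hq
  have hcont : ContinuousOn f (Set.Ioo a b) := fun t ht =>
    (hf.differentiableAt t ht).continuousAt.continuousWithinAt
  refine .of_bound (hcont.aestronglyMeasurable measurableSet_Ioo) (C * ‖![f s, deriv f s]‖) ?_
  filter_upwards [ae_restrict_mem measurableSet_Ioo] with t ht
  exact (norm_le_pi_norm ![f t, deriv f t] 0).trans (hC s hs t ht)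

end IsCaratheodorySolution

theorem eq_of_eventually_eq_of_isPreconnected {X β : Type*} [TopologicalSpace X] {U : Set X}
    (hU : IsPreconnected U) {F : X → β} (hF : ∀ x ∈ U, ∀ᶠ y in 𝓝 x, F y = F x) {x y : X}
    (hx : x ∈ U) (hy : y ∈ U) : F x = F y := by
  refine hU.induction₂' (fun x y => F x = F y) (fun x hx => ?_)
    (fun _ _ _ _ _ _ => Eq.trans) hx hy
  filter_upwards [nhdsWithin_le_nhds (hF x hx)] with y hy using ⟨hy.symm, hy⟩

section ExtendedIntervals

variable {c d c' d' : EReal} {W : Set ℝ}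

theorem isOpen_eIoo (c d : EReal) : IsOpen (eIoo c d) :=
  isOpen_Ioo.preimage continuous_coe_real_ereal

theorem ordConnected_eIoo (c d : EReal) : (eIoo c d).OrdConnected :=
  Set.ordConnected_Ioo.preimage_mono EReal.coe_strictMono.monotone

theorem measurableSet_eIoo (c d : EReal) : MeasurableSet (eIoo c d) :=
  (isOpen_eIoo c d).measurableSet

theorem eIoo_subset_eIoo (hc : c' ≤ c) (hd : d ≤ d') : eIoo c d ⊆ eIoo c' d' :=
  fun _ ht => ⟨hc.trans_lt ht.1, ht.2.trans_le hd⟩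

theorem eIoo_mem_atLeftEnd (h : c < d) : eIoo c d ∈ atLeftEnd c :=
  preimage_mem_comap (Ioo_mem_nhdsGT h)

theorem eIoo_mem_atRightEnd (h : c < d) : eIoo c d ∈ atRightEnd d :=
  preimage_mem_comap (Ioo_mem_nhdsLT h)

theorem atLeftEnd_coe (t : ℝ) : atLeftEnd t = 𝓝[>] t := by
  rw [atLeftEnd, nhdsWithin, comap_inf, comap_principal, ← EReal.isEmbedding_coe.nhds_eq_comap]
  simp only [Set.preimage, Set.mem_Ioi, EReal.coe_lt_coe_iff]
  rfl

theorem atRightEnd_coe (t : ℝ) : atRightEnd t = 𝓝[<] t := by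
  rw [atRightEnd, nhdsWithin, comap_inf, comap_principal, ← EReal.isEmbedding_coe.nhds_eq_comap]
  simp only [Set.preimage, Set.mem_Iio, EReal.coe_lt_coe_iff]
  rfl

theorem exists_eIoo_subset_of_mem_atLeftEnd (h : c < d) (hW : W ∈ atLeftEnd c) :
    ∃ t ∈ eIoo c d, eIoo c t ⊆ W := by
  obtain ⟨V, hV, hVW⟩ := mem_comap.1 hW
  obtain ⟨e, he, heV⟩ := (mem_nhdsGT_iff_exists_Ioo_subset' h).1 hV
  obtain ⟨t, hct, ht⟩ := EReal.lt_iff_exists_real_btwn.1 (lt_min he h)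
  exact ⟨t, ⟨hct, ht.trans_le (min_le_right _ _)⟩, fun s hs =>
    hVW (heV ⟨hs.1, hs.2.trans (ht.trans_le (min_le_left _ _))⟩)⟩

theorem exists_eIoo_subset_of_mem_atRightEnd (h : c < d) (hW : W ∈ atRightEnd d) :
    ∃ t ∈ eIoo c d, eIoo t d ⊆ W := by
  obtain ⟨V, hV, hVW⟩ := mem_comap.1 hW
  obtain ⟨e, he, heV⟩ := (mem_nhdsLT_iff_exists_Ioo_subset' h).1 hV
  obtain ⟨t, ht, htd⟩ := EReal.lt_iff_exists_real_btwn.1 (max_lt he h)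
  exact ⟨t, ⟨(le_max_right _ _).trans_lt ht, htd⟩, fun s hs =>
    hVW (heV ⟨((le_max_left _ _).trans_lt ht).trans hs.1, hs.2⟩)⟩

end ExtendedIntervals

namespace PointInteractionData

variable {S : PointInteractionData} {c d : EReal} {l : Filter ℝ} {t : ℝ}

theorem countable_M : S.M.Countable := Set.countable_range _

theorem eventually_notMem_M (ht : ¬ AccPt t (𝓟 S.M)) : ∀ᶠ s in 𝓝[≠] t, s ∉ S.M := by
  rwa [accPt_iff_frequently_nhdsNE, not_frequently] at ht

theorem compl_M_mem_nhds (ht : t ∈ eIoo S.a S.b) (htM : t ∉ S.M) : S.Mᶜ ∈ 𝓝 t := by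
  have hne : ∀ᶠ s in 𝓝[≠] t, s ∉ S.M := eventually_notMem_M (S.x_discrete t ht)
  rw [← nhdsNE_sup_pure t]
  exact mem_sup.2 ⟨hne, htM⟩

/-- The coefficient `q` in the form `f'' = q f` of the equation `τ f = z f`. -/
noncomputable def shiftedPotential (S : PointInteractionData) (z : ℂ) (t : ℝ) : ℂ := S.V t - z

theorem integrableOn_shiftedPotential {U : Set ℝ} (hV : IntegrableOn S.V U)
    (hU : volume U ≠ ⊤) (z : ℂ) : IntegrableOn (S.shiftedPotential z) U :=
  hV.ofReal.sub (integrableOn_const hU)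

/-- The filter `l` is a one-sided neighbourhood filter on which the expression `τ` is regular: it
contains arbitrarily small bounded open intervals that are free of interaction points and on which
`V` is integrable. This covers both sides of an interior point as well as regular endpoints. -/
def IsRegularSide (S : PointInteractionData) (l : Filter ℝ) : Prop :=
  ∀ W ∈ l, ∃ p q : ℝ, Set.Ioo p q ∈ l ∧ Set.Ioo p q ⊆ W \ S.M ∧ IntegrableOn S.V (Set.Ioo p q)

theorem isRegularSide_nhdsGT (hV : IntegrableAtFilter S.V (𝓝[>] t)) (hM : ¬ AccPt t (𝓟 S.M)) :
    S.IsRegularSide (𝓝[>] t) := by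
  intro W hW
  obtain ⟨U, hU, hVU⟩ := hV
  have hM' : S.Mᶜ ∈ 𝓝[>] t := (eventually_notMem_M hM).filter_mono (nhdsGT_le_nhdsNE t)
  obtain ⟨q, hq, hqsub⟩ := mem_nhdsGT_iff_exists_Ioo_subset.1 (inter_mem (inter_mem hW hM') hU)
  exact ⟨t, q, Ioo_mem_nhdsGT hq, fun s hs => (hqsub hs).1, hVU.mono_set fun s hs => (hqsub hs).2⟩

theorem isRegularSide_nhdsLT (hV : IntegrableAtFilter S.V (𝓝[<] t)) (hM : ¬ AccPt t (𝓟 S.M)) :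
    S.IsRegularSide (𝓝[<] t) := by
  intro W hW
  obtain ⟨U, hU, hVU⟩ := hV
  have hM' : S.Mᶜ ∈ 𝓝[<] t := (eventually_notMem_M hM).filter_mono (nhdsLT_le_nhdsNE t)
  obtain ⟨p, hp, hpsub⟩ := mem_nhdsLT_iff_exists_Ioo_subset.1 (inter_mem (inter_mem hW hM') hU)
  exact ⟨p, t, Ioo_mem_nhdsLT hp, fun s hs => (hpsub hs).1, hVU.mono_set fun s hs => (hpsub hs).2⟩

theorem integrableAtFilter_nhds (ht : t ∈ eIoo S.a S.b) : IntegrableAtFilter S.V (𝓝 t) :=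
  (isOpen_eIoo S.a S.b).nhdsWithin_eq ht ▸ S.V_locallyIntegrable t ht

theorem isRegularSide_right (ht : t ∈ eIoo S.a S.b) : S.IsRegularSide (𝓝[>] t) :=
  isRegularSide_nhdsGT ((integrableAtFilter_nhds ht).filter_mono nhdsWithin_le_nhds)
    (S.x_discrete t ht)

theorem isRegularSide_left (ht : t ∈ eIoo S.a S.b) : S.IsRegularSide (𝓝[<] t) :=
  isRegularSide_nhdsLT ((integrableAtFilter_nhds ht).filter_mono nhdsWithin_le_nhds)
    (S.x_discrete t ht)

theorem RegularLeft.isRegularSide (h : S.RegularLeft) : S.IsRegularSide (atLeftEnd S.a) := by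
  obtain ⟨a₀, ha, hV, hM⟩ := h
  have hmem : eIoo S.a S.b ∈ 𝓝[>] a₀ := atLeftEnd_coe a₀ ▸ ha ▸ eIoo_mem_atLeftEnd S.a_lt_b
  rw [ha, atLeftEnd_coe]
  refine isRegularSide_nhdsGT ((hV a₀ (Set.mem_insert _ _)).filter_mono ?_) hM
  exact nhdsWithin_le_iff.2 (mem_of_superset hmem (Set.subset_insert _ _))

theorem RegularRight.isRegularSide (h : S.RegularRight) : S.IsRegularSide (atRightEnd S.b) := by
  obtain ⟨b₀, hb, hV, hM⟩ := h
  have hmem : eIoo S.a S.b ∈ 𝓝[<] b₀ := atRightEnd_coe b₀ ▸ hb ▸ eIoo_mem_atRightEnd S.a_lt_b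
  rw [hb, atRightEnd_coe]
  refine isRegularSide_nhdsLT ((hV b₀ (Set.mem_insert _ _)).filter_mono ?_) hM
  exact nhdsWithin_le_iff.2 (mem_of_superset hmem (Set.subset_insert _ _))

namespace IsSolutionOn

variable {Λ Λ' R Θ : S.I → ℝ} {z : ℂ} {c' d' : EReal} {f g h : ℝ → ℂ} {s : ℝ}

theorem mono (hf : S.IsSolutionOn Λ R Θ z c d f) (hsub : eIoo c' d' ⊆ eIoo c d)
    (hΛ : ∀ n, S.x n ∈ eIoo c' d' → Λ n = Λ' n) : S.IsSolutionOn Λ' R Θ z c' d' f := by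
  obtain ⟨⟨hdiff, hac, hac'⟩, heq, hint⟩ := hf
  have hsub' : eIoo c' d' \ S.M ⊆ eIoo c d \ S.M := Set.sdiff_subset_sdiff_left hsub
  refine ⟨⟨fun t ht => hdiff t (hsub' ht), hac.mono hsub', hac'.mono hsub'⟩,
    ae_restrict_of_ae_restrict_of_subset hsub heq, fun n hn => ?_⟩
  rw [← hΛ n hn]
  exact hint n (hsub hn)

theorem isCaratheodorySolution (hf : S.IsSolutionOn Λ R Θ z c d f) :
    IsCaratheodorySolution (S.shiftedPotential z) (eIoo c d \ S.M) f where
  differentiableAt := hf.1.1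
  ac := hf.1.2.1
  ac_deriv := hf.1.2.2
  ae_eq := by
    filter_upwards [(ae_restrict_iff' (measurableSet_eIoo c d)).1 hf.2.1] with t ht htU
    have htau : -deriv (deriv f) t + S.V t * f t - z * f t = 0 := ht htU.1
    rw [shiftedPotential]
    linear_combination -htau

theorem ae_jet_eq (hf : S.IsSolutionOn Λ R Θ z c d f) (hcd : eIoo c d ⊆ eIoo S.a S.b) :
    ∀ᵐ t ∂volume.restrict (eIoo c d), jet f t = ![f t, deriv f t] := by
  filter_upwards [ae_restrict_mem (measurableSet_eIoo c d),
    ae_restrict_of_ae (countable_M.ae_notMem volume)] with t ht htM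
  exact hf.isCaratheodorySolution.jet_eq
    (inter_mem ((isOpen_eIoo c d).mem_nhds ht) (compl_M_mem_nhds (hcd ht) htM))

theorem exists_satisfiesInterface (hR : ∀ n, R n ≠ 0) (hcd : eIoo c d ⊆ eIoo S.a S.b)
    (ht : t ∈ eIoo c d) :
    ∃ A : Matrix (Fin 2) (Fin 2) ℝ, A.det = 1 ∧
      ∀ f, S.IsSolutionOn Λ R Θ z c d f → SatisfiesInterface A t f := by
  by_cases htM : t ∈ S.M
  · obtain ⟨n, rfl⟩ := htM
    exact ⟨_, det_interactionMatrix (Λ n) (Θ n) (hR n), fun f hf => hf.2.2 n ht⟩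
  · refine ⟨1, Matrix.det_one, fun f hf => satisfiesInterface_one
      (hf.1.1 t ⟨ht, htM⟩).continuousAt (hf.isCaratheodorySolution.continuousAt_deriv ?_)⟩
    exact inter_mem ((isOpen_eIoo c d).mem_nhds ht) (compl_M_mem_nhds (hcd ht) htM)

theorem exists_tendsto_jet (hf : S.IsSolutionOn Λ R Θ z c d f) (hcd : eIoo c d ⊆ eIoo S.a S.b)
    (ht : t ∈ eIoo c d) {A : Matrix (Fin 2) (Fin 2) ℝ} (hA : SatisfiesInterface A t f) :
    ∃ y, Tendsto (jet f) (𝓝[<] t) (𝓝 y) ∧ Tendsto (jet f) (𝓝[>] t) (𝓝 (jet f t)) ∧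
      jet f t = (A.map Complex.ofReal).mulVec y := by
  obtain ⟨y, hleft, hright, hy⟩ := hA.exists_tendsto
  have hjet : (fun s => ![f s, deriv f s]) =ᶠ[𝓝[≠] t] jet f := by
    filter_upwards [eventually_notMem_M (S.x_discrete t (hcd ht)),
      nhdsWithin_le_nhds ((isOpen_eIoo c d).mem_nhds ht)] with s hsM hs
    exact (hf.isCaratheodorySolution.jet_eq
      (inter_mem ((isOpen_eIoo c d).mem_nhds hs) (compl_M_mem_nhds (hcd hs) hsM))).symm
  exact ⟨y, hleft.congr' (hjet.filter_mono (nhdsLT_le_nhdsNE t)),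
    hright.congr' (hjet.filter_mono (nhdsGT_le_nhdsNE t)), hy⟩

theorem eventually_symplecticForm_eq_of_tendsto [l.NeBot] (hf : S.IsSolutionOn Λ R Θ z c d f)
    (hg : S.IsSolutionOn Λ R Θ z c d g) (hl : S.IsRegularSide l) (hcd : eIoo c d ∈ l)
    {y y' : Fin 2 → ℂ} (hy : Tendsto (jet f) l (𝓝 y)) (hy' : Tendsto (jet g) l (𝓝 y')) :
    ∀ᶠ s in l, symplecticForm (jet f s) (jet g s) = symplecticForm y y' := by
  obtain ⟨p, q, hpq, hsub, -⟩ := hl _ hcd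
  filter_upwards [hpq] with s hs
  exact (hf.isCaratheodorySolution.mono hsub).symplecticForm_jet_eq_of_tendsto
    (hg.isCaratheodorySolution.mono hsub) hs hpq hy hy'

theorem eventually_jet_eq_zero_iff_of_tendsto [l.NeBot] (hf : S.IsSolutionOn Λ R Θ z c d f)
    (hl : S.IsRegularSide l) (hcd : eIoo c d ∈ l) {y : Fin 2 → ℂ}
    (hy : Tendsto (jet f) l (𝓝 y)) : ∀ᶠ s in l, jet f s = 0 ↔ y = 0 := by
  obtain ⟨p, q, hpq, hsub, hV⟩ := hl _ hcd
  filter_upwards [hpq] with s hs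
  exact (hf.isCaratheodorySolution.mono hsub).jet_eq_zero_iff_of_tendsto
    (integrableOn_shiftedPotential hV (by simp) z) hs hpq hy

theorem eventually_symplecticForm_eq (hR : ∀ n, R n ≠ 0) (hf : S.IsSolutionOn Λ R Θ z c d f)
    (hg : S.IsSolutionOn Λ R Θ z c d g) (hcd : eIoo c d ⊆ eIoo S.a S.b) (ht : t ∈ eIoo c d) :
    ∀ᶠ s in 𝓝 t, symplecticForm (jet f s) (jet g s) = symplecticForm (jet f t) (jet g t) := by
  obtain ⟨A, hdet, hA⟩ := exists_satisfiesInterface (Λ := Λ) (Θ := Θ) (z := z) hR hcd ht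
  obtain ⟨y, hyl, hyr, hy⟩ := hf.exists_tendsto_jet hcd ht (hA f hf)
  obtain ⟨y', hyl', hyr', hy'⟩ := hg.exists_tendsto_jet hcd ht (hA g hg)
  have hnhds : eIoo c d ∈ 𝓝 t := (isOpen_eIoo c d).mem_nhds ht
  have hω : symplecticForm (jet f t) (jet g t) = symplecticForm y y' := by
    rw [hy, hy', symplecticForm_mulVec, det_map_ofReal, hdet, Complex.ofReal_one, one_mul]
  rw [← nhdsNE_sup_pure, ← nhdsLT_sup_nhdsGT, eventually_sup, eventually_sup, eventually_pure]
  refine ⟨⟨?_, ?_⟩, rfl⟩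
  · rw [hω]
    exact hf.eventually_symplecticForm_eq_of_tendsto hg (isRegularSide_left (hcd ht))
      (nhdsWithin_le_nhds hnhds) hyl hyl'
  · exact hf.eventually_symplecticForm_eq_of_tendsto hg (isRegularSide_right (hcd ht))
      (nhdsWithin_le_nhds hnhds) hyr hyr'

theorem symplecticForm_eq (hR : ∀ n, R n ≠ 0) (hf : S.IsSolutionOn Λ R Θ z c d f)
    (hg : S.IsSolutionOn Λ R Θ z c d g) (hcd : eIoo c d ⊆ eIoo S.a S.b) (hs : s ∈ eIoo c d)
    (ht : t ∈ eIoo c d) :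
    symplecticForm (jet f s) (jet g s) = symplecticForm (jet f t) (jet g t) :=
  eq_of_eventually_eq_of_isPreconnected (F := fun r => symplecticForm (jet f r) (jet g r))
    (ordConnected_eIoo c d).isPreconnected
    (fun _ hx => hf.eventually_symplecticForm_eq hR hg hcd hx) hs ht

theorem eventually_jet_eq_zero_iff (hR : ∀ n, R n ≠ 0) (hf : S.IsSolutionOn Λ R Θ z c d f)
    (hcd : eIoo c d ⊆ eIoo S.a S.b) (ht : t ∈ eIoo c d) :
    ∀ᶠ s in 𝓝 t, jet f s = 0 ↔ jet f t = 0 := by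
  obtain ⟨A, hdet, hA⟩ := exists_satisfiesInterface (Λ := Λ) (Θ := Θ) (z := z) hR hcd ht
  obtain ⟨y, hyl, hyr, hy⟩ := hf.exists_tendsto_jet hcd ht (hA f hf)
  have hnhds : eIoo c d ∈ 𝓝 t := (isOpen_eIoo c d).mem_nhds ht
  have hzero : jet f t = 0 ↔ y = 0 := by
    refine ⟨fun h0 => Matrix.eq_zero_of_mulVec_eq_zero ?_ (hy.symm.trans h0), fun h0 => ?_⟩
    · simp [det_map_ofReal, hdet]
    · rw [hy, h0, Matrix.mulVec_zero]
  rw [← nhdsNE_sup_pure, ← nhdsLT_sup_nhdsGT, eventually_sup, eventually_sup, eventually_pure]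
  refine ⟨⟨?_, ?_⟩, Iff.rfl⟩
  · rw [hzero]
    exact hf.eventually_jet_eq_zero_iff_of_tendsto (isRegularSide_left (hcd ht))
      (nhdsWithin_le_nhds hnhds) hyl
  · exact hf.eventually_jet_eq_zero_iff_of_tendsto (isRegularSide_right (hcd ht))
      (nhdsWithin_le_nhds hnhds) hyr

theorem jet_eq_zero (hR : ∀ n, R n ≠ 0) (hf : S.IsSolutionOn Λ R Θ z c d f)
    (hcd : eIoo c d ⊆ eIoo S.a S.b) (hs : s ∈ eIoo c d) (h0 : jet f s = 0) (ht : t ∈ eIoo c d) :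
    jet f t = 0 :=
  (eq_of_eventually_eq_of_isPreconnected (F := fun r => jet f r = 0)
    (ordConnected_eIoo c d).isPreconnected (fun _ hx =>
      (hf.eventually_jet_eq_zero_iff hR hcd hx).mono fun _ hr => propext hr) hs ht).mp h0

theorem ae_eq_zero (hR : ∀ n, R n ≠ 0) (hf : S.IsSolutionOn Λ R Θ z c d f)
    (hcd : eIoo c d ⊆ eIoo S.a S.b) (hs : s ∈ eIoo c d) (h0 : jet f s = 0) :
    f =ᵐ[volume.restrict (eIoo c d)] 0 := by
  filter_upwards [hf.ae_jet_eq hcd, ae_restrict_mem (measurableSet_eIoo c d)] with t hjet ht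
  exact congrFun (hjet.symm.trans (hf.jet_eq_zero hR hcd hs h0 ht)) 0

theorem memLp_of_symplecticForm_ne_zero (hR : ∀ n, R n ≠ 0) (hcd : eIoo c d ⊆ eIoo S.a S.b)
    (hf : S.IsSolutionOn Λ R Θ z c d f) (hg : S.IsSolutionOn Λ R Θ z c d g)
    (hh : S.IsSolutionOn Λ R Θ z c d h) {p : ENNReal}
    (hf_memLp : MemLp f p (volume.restrict (eIoo c d)))
    (hg_memLp : MemLp g p (volume.restrict (eIoo c d)))
    (ht : t ∈ eIoo c d) (hne : symplecticForm (jet f t) (jet g t) ≠ 0) :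
    MemLp h p (volume.restrict (eIoo c d)) := by
  refine MemLp.ae_eq ?_ (((hf_memLp.const_mul (symplecticForm (jet h t) (jet g t))).sub
    (hg_memLp.const_mul (symplecticForm (jet h t) (jet f t)))).const_mul
      (symplecticForm (jet f t) (jet g t))⁻¹)
  filter_upwards [ae_restrict_mem (measurableSet_eIoo c d), hf.ae_jet_eq hcd, hg.ae_jet_eq hcd,
    hh.ae_jet_eq hcd] with s hs hfs hgs hhs
  have hdecomp : symplecticForm (jet f t) (jet g t) • jet h s =
      symplecticForm (jet h t) (jet g t) • jet f s -
        symplecticForm (jet h t) (jet f t) • jet g s := by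
    rw [hf.symplecticForm_eq hR hg hcd ht hs, hh.symplecticForm_eq hR hg hcd ht hs,
      hh.symplecticForm_eq hR hf hcd ht hs, symplecticForm_smul]
  rw [hfs, hgs, hhs] at hdecomp
  rw [inv_mul_eq_iff_eq_mul₀ hne]
  exact (congrFun hdecomp 0).symm

end IsSolutionOn

section Endpoints

variable {Λ Λ' Λ'' R R' Θ Θ' : S.I → ℝ} {z ζ : ℂ} {c' d' : EReal} {v w : ℝ → ℝ} {f g : ℝ → ℂ}

theorem IsRegularSide.symplecticForm_eq_zero (hl : S.IsRegularSide l) (hR : ∀ n, R n ≠ 0)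
    (hv : S.IsSolutionOn Λ' R' Θ' ζ c d fun t => (v t : ℂ)) (hcd : eIoo c d ∈ l)
    (hv0 : ∃ᶠ t in l, v t ≠ 0) (hf : S.IsSolutionOn Λ R Θ z c' d' f)
    (hg : S.IsSolutionOn Λ R Θ z c' d' g) (hcd' : eIoo c' d' ∈ l)
    (hsub : eIoo c' d' ⊆ eIoo S.a S.b)
    (hvf : Tendsto (lagrangeBracket (fun t => (v t : ℂ)) f) l (𝓝 0))
    (hvg : Tendsto (lagrangeBracket (fun t => (v t : ℂ)) g) l (𝓝 0)) (ht : t ∈ eIoo c' d') :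
    symplecticForm (jet f t) (jet g t) = 0 := by
  obtain ⟨p, q, hpq, hpq_sub, hV⟩ := hl _ (inter_mem hcd hcd')
  obtain ⟨s, hvs, hs⟩ := (hv0.and_eventually hpq).exists
  have : l.NeBot := ⟨fun h => hv0 (h ▸ eventually_bot)⟩
  have hI (z : ℂ) : IntegrableOn (S.shiftedPotential z) (Set.Ioo p q) :=
    integrableOn_shiftedPotential hV (by simp) z
  have hv' := hv.isCaratheodorySolution.mono fun r hr => ⟨(hpq_sub hr).1.1, (hpq_sub hr).2⟩
  have hf' := hf.isCaratheodorySolution.mono fun r hr => ⟨(hpq_sub hr).1.2, (hpq_sub hr).2⟩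
  have hg' := hg.isCaratheodorySolution.mono fun r hr => ⟨(hpq_sub hr).1.2, (hpq_sub hr).2⟩
  have hv_ne : jet (fun t => (v t : ℂ)) s ≠ 0 := fun h0 => by
    rw [hv'.jet_eqOn isOpen_Ioo hs] at h0
    exact hvs (Complex.ofReal_eq_zero.1 (congrFun h0 0))
  have hbracket (k : ℝ → ℂ) : lagrangeBracket (fun t => (v t : ℂ)) k =ᶠ[l]
      fun r => symplecticForm (jet (fun t => (v t : ℂ)) r) (jet k r) := by
    filter_upwards [hpq] with r hr
    exact lagrangeBracket_ofReal (hv'.differentiableAt r hr).continuousAt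
      (hv'.continuousAt_deriv (isOpen_Ioo.mem_nhds hr))
  refine eq_zero_of_tendsto_symplecticForm ?_ (hf'.isBigO_jet_one (hI z) hs hpq)
    (hg'.isBigO_jet_one (hI z) hs hpq) (hv'.isBigO_one_jet (hI ζ) hs hv_ne hpq)
    (hvf.congr' (hbracket f)) (hvg.congr' (hbracket g))
  filter_upwards [hcd'] with r hr using hf.symplecticForm_eq hR hg hsub hr ht

theorem RegularLeft.limitCircleLeft (h : S.RegularLeft) : S.LimitCircleLeft Λ R Θ := by
  intro z f hf
  obtain ⟨p, q, hpq, hpq_sub, hV⟩ := h.isRegularSide _ (eIoo_mem_atLeftEnd S.a_lt_b)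
  obtain ⟨t, ht, ht_sub⟩ := exists_eIoo_subset_of_mem_atLeftEnd S.a_lt_b hpq
  exact ⟨t, ht, ((hf.isCaratheodorySolution.mono hpq_sub).memLp
    (integrableOn_shiftedPotential hV (by simp) z) 2).mono_measure
      (Measure.restrict_mono_set _ ht_sub)⟩

theorem RegularRight.limitCircleRight (h : S.RegularRight) : S.LimitCircleRight Λ R Θ := by
  intro z f hf
  obtain ⟨p, q, hpq, hpq_sub, hV⟩ := h.isRegularSide _ (eIoo_mem_atRightEnd S.a_lt_b)
  obtain ⟨t, ht, ht_sub⟩ := exists_eIoo_subset_of_mem_atRightEnd S.a_lt_b hpq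
  exact ⟨t, ht, ((hf.isCaratheodorySolution.mono hpq_sub).memLp
    (integrableOn_shiftedPotential hV (by simp) z) 2).mono_measure
      (Measure.restrict_mono_set _ ht_sub)⟩

theorem LimitPointLeft.not_limitCircleLeft (h : S.LimitPointLeft Λ R Θ) :
    ¬ S.LimitCircleLeft Λ R Θ := fun hc =>
  let ⟨f, hf, hf'⟩ := h 0
  hf' (hc 0 f hf)

theorem LimitPointRight.not_limitCircleRight (h : S.LimitPointRight Λ R Θ) :
    ¬ S.LimitCircleRight Λ R Θ := fun hc =>
  let ⟨f, hf, hf'⟩ := h 0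
  hf' (hc 0 f hf)

theorem LimitPointLeft.symplecticForm_eq_zero (h : S.LimitPointLeft Λ R Θ) (hR : ∀ n, R n ≠ 0)
    {p : ℝ} (hp : p ∈ eIoo S.a S.b) (hf : S.IsSolutionOn Λ R Θ z S.a p f)
    (hg : S.IsSolutionOn Λ R Θ z S.a p g) (hf_memLp : MemLp f 2 (volume.restrict (eIoo S.a p)))
    (hg_memLp : MemLp g 2 (volume.restrict (eIoo S.a p))) (ht : t ∈ eIoo S.a p) :
    symplecticForm (jet f t) (jet g t) = 0 := by
  have hsub : eIoo S.a p ⊆ eIoo S.a S.b := eIoo_subset_eIoo le_rfl hp.2.le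
  by_contra hne
  obtain ⟨k, hk, hk_notMem⟩ := h z
  exact hk_notMem ⟨p, hp, hf.memLp_of_symplecticForm_ne_zero hR hsub hg
    (hk.mono hsub fun _ _ => rfl) hf_memLp hg_memLp ht hne⟩

theorem LimitPointRight.symplecticForm_eq_zero (h : S.LimitPointRight Λ R Θ) (hR : ∀ n, R n ≠ 0)
    {p : ℝ} (hp : p ∈ eIoo S.a S.b) (hf : S.IsSolutionOn Λ R Θ z p S.b f)
    (hg : S.IsSolutionOn Λ R Θ z p S.b g) (hf_memLp : MemLp f 2 (volume.restrict (eIoo p S.b)))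
    (hg_memLp : MemLp g 2 (volume.restrict (eIoo p S.b))) (ht : t ∈ eIoo p S.b) :
    symplecticForm (jet f t) (jet g t) = 0 := by
  have hsub : eIoo p S.b ⊆ eIoo S.a S.b := eIoo_subset_eIoo hp.1.le le_rfl
  by_contra hne
  obtain ⟨k, hk, hk_notMem⟩ := h z
  exact hk_notMem ⟨p, hp, hf.memLp_of_symplecticForm_ne_zero hR hsub hg
    (hk.mono hsub fun _ _ => rfl) hf_memLp hg_memLp ht hne⟩

/-- The standing assumption at `a`, uniform in `Λ`: either `a` is regular and `v` fixes a boundary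
condition there, or `a` is in the limit point case. -/
def RegularOrLimitPointLeft (S : PointInteractionData) (R Θ : S.I → ℝ) (v : ℝ → ℝ) : Prop :=
  (S.RegularLeft ∧ ∀ Λ, S.IsBoundarySolutionLeft Λ R Θ v) ∨ ∀ Λ, S.LimitPointLeft Λ R Θ

/-- The standing assumption at `b`, uniform in `Λ`: either `b` is regular and `w` fixes a boundary
condition there, or `b` is in the limit point case. -/
def RegularOrLimitPointRight (S : PointInteractionData) (R Θ : S.I → ℝ) (w : ℝ → ℝ) : Prop :=
  (S.RegularRight ∧ ∀ Λ, S.IsBoundarySolutionRight Λ R Θ w) ∨ ∀ Λ, S.LimitPointRight Λ R Θ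

theorem RegularOrLimitPointLeft.limitCircleLeft (h : S.RegularOrLimitPointLeft R Θ v)
    (hΛ : S.LimitCircleLeft Λ R Θ) : S.LimitCircleLeft Λ' R Θ :=
  h.elim (fun h => h.1.limitCircleLeft) fun h => absurd hΛ (h Λ).not_limitCircleLeft

theorem RegularOrLimitPointRight.limitCircleRight (h : S.RegularOrLimitPointRight R Θ w)
    (hΛ : S.LimitCircleRight Λ R Θ) : S.LimitCircleRight Λ' R Θ :=
  h.elim (fun h => h.1.limitCircleRight) fun h => absurd hΛ (h Λ).not_limitCircleRight

theorem RegularOrLimitPointLeft.symplecticForm_eq_zero (h : S.RegularOrLimitPointLeft R Θ v)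
    (hR : ∀ n, R n ≠ 0) {p : ℝ} (hp : p ∈ eIoo S.a S.b)
    (hf : S.IsSolutionOn Λ R Θ z S.a p f) (hg : S.IsSolutionOn Λ R Θ z S.a p g)
    (hf_memLp : MemLp f 2 (volume.restrict (eIoo S.a p)))
    (hg_memLp : MemLp g 2 (volume.restrict (eIoo S.a p)))
    (hvf : S.LimitCircleLeft Λ' R Θ →
      Tendsto (lagrangeBracket (fun t => (v t : ℂ)) f) (atLeftEnd S.a) (𝓝 0))
    (hvg : S.LimitCircleLeft Λ'' R Θ →
      Tendsto (lagrangeBracket (fun t => (v t : ℂ)) g) (atLeftEnd S.a) (𝓝 0))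
    (ht : t ∈ eIoo S.a p) : symplecticForm (jet f t) (jet g t) = 0 := by
  rcases h with ⟨hreg, hv⟩ | hlp
  · obtain ⟨⟨E, c, hc, hv⟩, hv0⟩ := hv Λ
    exact hreg.isRegularSide.symplecticForm_eq_zero hR hv (eIoo_mem_atLeftEnd hc.1)
      (hv0.mono fun _ => And.right) hf hg (eIoo_mem_atLeftEnd hp.1)
      (eIoo_subset_eIoo le_rfl hp.2.le) (hvf hreg.limitCircleLeft) (hvg hreg.limitCircleLeft) ht
  · exact (hlp Λ).symplecticForm_eq_zero hR hp hf hg hf_memLp hg_memLp ht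

theorem RegularOrLimitPointRight.symplecticForm_eq_zero (h : S.RegularOrLimitPointRight R Θ w)
    (hR : ∀ n, R n ≠ 0) {p : ℝ} (hp : p ∈ eIoo S.a S.b)
    (hf : S.IsSolutionOn Λ R Θ z p S.b f) (hg : S.IsSolutionOn Λ R Θ z p S.b g)
    (hf_memLp : MemLp f 2 (volume.restrict (eIoo p S.b)))
    (hg_memLp : MemLp g 2 (volume.restrict (eIoo p S.b)))
    (hwf : S.LimitCircleRight Λ' R Θ →
      Tendsto (lagrangeBracket (fun t => (w t : ℂ)) f) (atRightEnd S.b) (𝓝 0))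
    (hwg : S.LimitCircleRight Λ'' R Θ →
      Tendsto (lagrangeBracket (fun t => (w t : ℂ)) g) (atRightEnd S.b) (𝓝 0))
    (ht : t ∈ eIoo p S.b) : symplecticForm (jet f t) (jet g t) = 0 := by
  rcases h with ⟨hreg, hw⟩ | hlp
  · obtain ⟨⟨E, c, hc, hw⟩, hw0⟩ := hw Λ
    exact hreg.isRegularSide.symplecticForm_eq_zero hR hw (eIoo_mem_atRightEnd hc.2)
      (hw0.mono fun _ => And.right) hf hg (eIoo_mem_atRightEnd hp.2)
      (eIoo_subset_eIoo hp.1.le le_rfl) (hwf hreg.limitCircleRight) (hwg hreg.limitCircleRight) ht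
  · exact (hlp Λ).symplecticForm_eq_zero hR hp hf hg hf_memLp hg_memLp ht

end Endpoints

section Eigenfunctions

variable {Λ Λ' R Θ : S.I → ℝ} {v w : ℝ → ℝ} {E : ℝ} {u u' : ℝ → ℂ} {p : ℝ}

/-- The function `u` represents an eigenvector of `H_{Λ,R,Θ}` for the eigenvalue `E`. -/
def IsEigenfunction (S : PointInteractionData) (v w : ℝ → ℝ) (Λ R Θ : S.I → ℝ) (E : ℝ)
    (u : ℝ → ℂ) : Prop :=
  u ∈ S.operatorDomain v w Λ R Θ ∧ ¬ u =ᵐ[volume.restrict (eIoo S.a S.b)] 0 ∧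
    S.tau u =ᵐ[volume.restrict (eIoo S.a S.b)] fun t => (E : ℂ) * u t

namespace IsEigenfunction

theorem isSolutionOn (hu : S.IsEigenfunction v w Λ R Θ E u) :
    S.IsSolutionOn Λ R Θ E S.a S.b u :=
  ⟨hu.1.1.2.1, hu.2.2.mono fun _ ht => sub_eq_zero.2 ht, hu.1.1.2.2.2⟩

theorem memLp (hu : S.IsEigenfunction v w Λ R Θ E u) {U : Set ℝ} (hU : U ⊆ eIoo S.a S.b) :
    MemLp u 2 (volume.restrict U) :=
  hu.1.1.1.mono_measure (Measure.restrict_mono_set _ hU)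

theorem jet_ne_zero (hu : S.IsEigenfunction v w Λ R Θ E u) (hR : ∀ n, R n ≠ 0)
    (hp : p ∈ eIoo S.a S.b) : jet u p ≠ 0 :=
  fun h0 => hu.2.1 (hu.isSolutionOn.ae_eq_zero hR subset_rfl hp h0)

theorem symplecticForm_eq_zero_left (hu : S.IsEigenfunction v w Λ R Θ E u)
    (hu' : S.IsEigenfunction v w Λ' R Θ E u') (hleft : S.RegularOrLimitPointLeft R Θ v)
    (hR : ∀ n, R n ≠ 0) (hp : p ∈ eIoo S.a S.b) (hΛ : ∀ m, S.x m ∈ eIoo S.a p → Λ' m = Λ m)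
    (ht : t ∈ eIoo S.a p) : symplecticForm (jet u t) (jet u' t) = 0 :=
  have hsub : eIoo S.a p ⊆ eIoo S.a S.b := eIoo_subset_eIoo le_rfl hp.2.le
  hleft.symplecticForm_eq_zero hR hp (hu.isSolutionOn.mono hsub fun _ _ => rfl)
    (hu'.isSolutionOn.mono hsub hΛ) (hu.memLp hsub) (hu'.memLp hsub) hu.1.2.1 hu'.1.2.1 ht

theorem symplecticForm_eq_zero_right (hu : S.IsEigenfunction v w Λ R Θ E u)
    (hu' : S.IsEigenfunction v w Λ' R Θ E u') (hright : S.RegularOrLimitPointRight R Θ w)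
    (hR : ∀ n, R n ≠ 0) (hp : p ∈ eIoo S.a S.b) (hΛ : ∀ m, S.x m ∈ eIoo p S.b → Λ' m = Λ m)
    (ht : t ∈ eIoo p S.b) : symplecticForm (jet u t) (jet u' t) = 0 :=
  have hsub : eIoo p S.b ⊆ eIoo S.a S.b := eIoo_subset_eIoo hp.1.le le_rfl
  hright.symplecticForm_eq_zero hR hp (hu.isSolutionOn.mono hsub fun _ _ => rfl)
    (hu'.isSolutionOn.mono hsub hΛ) (hu.memLp hsub) (hu'.memLp hsub) hu.1.2.2 hu'.1.2.2 ht

theorem jet_one_eq_zero (hu : S.IsEigenfunction v w Λ R Θ E u)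
    (hu' : S.IsEigenfunction v w Λ' R Θ E u') (hleft : S.RegularOrLimitPointLeft R Θ v)
    (hright : S.RegularOrLimitPointRight R Θ w) (hR : ∀ n, R n ≠ 0) {n : S.I} (hn : Λ n ≠ Λ' n)
    (hΛ : ∀ m, m ≠ n → Λ' m = Λ m) : jet u (S.x n) 1 = 0 := by
  have hx := S.x_mem n
  obtain ⟨y, hyl, hyr, hy⟩ :=
    hu.isSolutionOn.exists_tendsto_jet subset_rfl hx (hu.isSolutionOn.2.2 n hx)
  obtain ⟨y', hyl', hyr', hy'⟩ :=
    hu'.isSolutionOn.exists_tendsto_jet subset_rfl hx (hu'.isSolutionOn.2.2 n hx)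
  have hleft_zero : symplecticForm y y' = 0 := by
    refine tendsto_nhds_unique (tendsto_symplecticForm hyl hyl') (tendsto_const_nhds.congr' ?_)
    filter_upwards [atRightEnd_coe (S.x n) ▸ eIoo_mem_atRightEnd hx.1] with t ht
    exact (hu.symplecticForm_eq_zero_left hu' hleft hR hx
      (fun m hm => hΛ m fun h => lt_irrefl _ (h ▸ hm.2)) ht).symm
  have hright_zero : symplecticForm (jet u (S.x n)) (jet u' (S.x n)) = 0 := by
    refine tendsto_nhds_unique (tendsto_symplecticForm hyr hyr') (tendsto_const_nhds.congr' ?_)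
    filter_upwards [atLeftEnd_coe (S.x n) ▸ eIoo_mem_atLeftEnd hx.2] with t ht
    exact (hu.symplecticForm_eq_zero_right hu' hright hR hx
      (fun m hm => hΛ m fun h => lt_irrefl _ (h ▸ hm.1)) ht).symm
  rw [hy, hy'] at hright_zero
  rw [hy]
  exact apply_one_eq_zero_of_symplecticForm_interactionMatrix hn hleft_zero hright_zero
    (hy' ▸ hu'.jet_ne_zero hR hx)

theorem of_jet_one_eq_zero (hu : S.IsEigenfunction v w Λ R Θ E u)
    (hleft : S.RegularOrLimitPointLeft R Θ v) (hright : S.RegularOrLimitPointRight R Θ w)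
    (h0 : ∀ n, jet u (S.x n) 1 = 0) (Λ' : S.I → ℝ) : S.IsEigenfunction v w Λ' R Θ E u := by
  obtain ⟨⟨⟨hL2, hreg, htau, hint⟩, ha, hb⟩, hne, heq⟩ := hu
  exact ⟨⟨⟨hL2, hreg, htau, fun n hn => (hint n hn).of_jet_one_eq_zero (h0 n) _⟩,
    fun hlc => ha (hleft.limitCircleLeft hlc), fun hlc => hb (hright.limitCircleRight hlc)⟩,
    hne, heq⟩

end IsEigenfunction

theorem eigenvalueSet_eq_univ_of_forall_update_mem (hR : ∀ n, R n ≠ 0)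
    (hleft : S.RegularOrLimitPointLeft R Θ v) (hright : S.RegularOrLimitPointRight R Θ w)
    (hΛ : Λ ∈ S.eigenvalueSet v w R Θ E)
    (hupdate : ∀ n, ∃ t, t ≠ Λ n ∧ Function.update Λ n t ∈ S.eigenvalueSet v w R Θ E) :
    S.eigenvalueSet v w R Θ E = Set.univ := by
  obtain ⟨u, hu⟩ : ∃ u, S.IsEigenfunction v w Λ R Θ E u := hΛ
  refine Set.eq_univ_of_forall fun Λ' => ⟨u, hu.of_jet_one_eq_zero hleft hright (fun n => ?_) Λ'⟩
  obtain ⟨t, ht, hut⟩ := hupdate n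
  obtain ⟨u', hu'⟩ : ∃ u', S.IsEigenfunction v w (Function.update Λ n t) R Θ E u' := hut
  refine hu.jet_one_eq_zero hu' hleft hright hR ?_ fun m hm => Function.update_of_ne hm _ _
  rw [Function.update_self]
  exact ht.symm

end Eigenfunctions

end PointInteractionData

theorem mainTheorem1 (S : PointInteractionData)
    (R Θ : S.I → ℝ) (hR : ∀ n, 0 < R n)
    (v w : ℝ → ℝ)
    (hleft : (S.RegularLeft ∧ ∀ Λ, S.IsBoundarySolutionLeft Λ R Θ v) ∨
      ∀ Λ, S.LimitPointLeft Λ R Θ)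
    (hright : (S.RegularRight ∧ ∀ Λ, S.IsBoundarySolutionRight Λ R Θ w) ∨
      ∀ Λ, S.LimitPointRight Λ R Θ)
    (p : S.I → Measure ℝ) [∀ n, IsProbabilityMeasure (p n)]
    (hp : ∀ n t, p n {t} = 0)
    (E : ℝ) (B : Set (S.I → ℝ))
    -- measurability with respect to the completed product σ-algebra
    (hB : NullMeasurableSet B (Measure.infinitePi p))
    (hBE : B ⊆ S.eigenvalueSet v w R Θ E) :
    Measure.infinitePi p B = 0 ∨ S.eigenvalueSet v w R Θ E = Set.univ := by
  refine or_iff_not_imp_left.2 fun hB0 => ?_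
  have (n : S.I) : NullSingletonClass (p n) := ⟨hp n⟩
  obtain ⟨Λ, hΛ, hupdate⟩ := exists_forall_update_mem p hB hB0
  refine PointInteractionData.eigenvalueSet_eq_univ_of_forall_update_mem (fun n => (hR n).ne')
    hleft hright (hBE hΛ) fun n => ?_
  obtain ⟨t, ht, htB⟩ := hupdate n
  exact ⟨t, ht, hBE htB⟩
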